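/- Fix real constants $R_{\min}>0$, $R_{\max}$, $C$, an integer $\omega\ge 1$ and $0<\varepsilon<2$. **General adversarial queue systems.** There are finitely many queues $1,\dots,n$, some of which may be destination queues; $q_v^t\ge 0$ is the size of queue $v$ at time $t=0,1,2,\dots$, and destination queues always have size $0$. At each time $t$ an adversary chooses a set of feasible rate vectors $(r_{uv})$ indexed by the ordered pairs of queues (links), where each $r_{uv}$ is $0$ or lies in $[R_{\min},R_{\max}]$, and finitely many packets $p$, each with a size $\ell_p\ge R_{\min}$ and a queue into which it is injected, such that the total size $a_v^t$ of the packets injected into any one queue $v$ at time $t$ is at most $R_{\max}$. Then the scheduling algorithm $Alg$ chooses a feasible rate vector $r(t)$ and amounts $0\le s_{uv}(t)\le r_{uv}(t)$ with $\sum_v s_{uv}(t)\le q_u^t$, and sends $s_{uv}(t)$ from $u$ to $v$. The new sizes are $q_v^{t+1}=q_v^t-\sum_u s_{vu}(t)+\sum_u s_{uv}(t)+a_v^t$ for non-destination queues; data in a destination queue is removed. **Bad packets.** An assignment of partial transmissions gives each packet $p$, injected at time $t_p$, amounts $\Gamma_p(t,u,v)\ge 0$ that vanish for $t\notin[t_p,t_p+\omega-1]$,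 such that $\sum_p\Gamma_p(t,u,v)\le s_{uv}(t)$ for all $t,u,v$. Consider the potential $\sum_v (q_v)^2$. The transmission on $(u,v)$ at time $t$ changes it by $$c_{uv}(t)=(q_v^t+s_{uv}(t))^2-(q_v^t)^2+(q_u^t-s_{uv}(t))^2-(q_u^t)^2 .$$ If $p$ is injected into a queue of height $q$ (its size at time $t_p$), the potential change due to $p$ is $$\Delta_p=(q+\ell_p)^2-q^2+\sum_{t=t_p}^{t_p+\omega-1}\sum_{u,v}\frac{\Gamma_p(t,u,v)}{s_{uv}(t)}\,c_{uv}(t)$$ (terms with $s_{uv}(t)=0$ are $0$). The packet is *bad* if $\Delta_p\ge-\frac{\varepsilon}{1-\varepsilon/2}\,\ell_p\,q+C+1$. The adversary is an $(\omega,\varepsilon,b)$-adversary, with corresponding algorithm $Alg$, if there is an assignment of partial transmissions of $Alg$ for which at most $b$ packets are bad over all time. **Theorem.** There are constants $U(n,q_0,b)$, depending only on $n$, $q_0$, $b$ (and on the fixed $R_{\min},R_{\max},C,\omega,\varepsilon$), such that the following holds for every general adversarial queue system with $n$ queues controlled by an $(\omega,\varepsilon,b)$-adversary with corresponding scheduling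 algorithm $Alg$. If $Alg$ only ever moves data from a taller queue to a shorter queue (that is, $s_{uv}(t)>0$ implies $q_u^t>q_v^t$), then $Alg$ is stable, i.e. the sizes of all queues stay bounded over all time; and if all queue sizes at time $0$ are at most $q_0$, then $q_v^t\le U(n,q_0,b)$ for all queues $v$ and all times $t\ge 0$. -/

import Mathlib

/-- One play of the game between the adversary and the scheduling algorithm in a general adversarial
queue system with `n` queues. At each time `t` the adversary chooses the set `feasible t` of feasible
rate vectors (a rate for every link, i.e. every ordered pair of queues) and the `count t` packets that
are injected. The algorithm then chooses a rate vector `rate t` and sends an amount `send t u v` of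
data from queue `u` to queue `v`. `dest` is the set of destination queues. Nothing restricts how the
moves depend on the past, so the plays of adaptive adversaries and of arbitrary algorithms are covered. -/
structure QueuePlay (n : ℕ) where
  dest : Set (Fin n)
  init : Fin n → ℝ
  feasible : ℕ → Set (Fin n → Fin n → ℝ)
  count : ℕ → ℕ
  source : (t : ℕ) → Fin (count t) → Fin n
  size : (t : ℕ) → Fin (count t) → ℝ
  rate : ℕ → Fin n → Fin n → ℝ
  send : ℕ → Fin n → Fin n → ℝ

namespace QueuePlay

variable {n : ℕ}

/-- A packet: its injection time and its number among the packets injected at that time. -/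
abbrev Packet (S : QueuePlay n) : Type := Σ t : ℕ, Fin (S.count t)

/-- The amount of data injected into queue `v` at time `t`. -/
noncomputable def injected (S : QueuePlay n) (t : ℕ) (v : Fin n) : ℝ :=
  ∑ k : Fin (S.count t), if S.source t k = v then S.size t k else 0

open Classical in
/-- The size of queue `v` at time `t`. In each time step data is transmitted, then the injected
packets are accepted, then all data that is in a destination queue is removed. -/
noncomputable def queue (S : QueuePlay n) : ℕ → Fin n → ℝ
  | 0, v => S.init v
  | t + 1, v =>
      if v ∈ S.dest then 0
      else S.queue t v - ∑ u, S.send t v u + ∑ u, S.send t u v + S.injected t v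

/-- The rules of the game, with arrivals and rates bounded from above by `Rmax`, and with nonzero
link rates and packet sizes bounded from below by `Rmin`. -/
structure Admissible (S : QueuePlay n) (Rmin Rmax : ℝ) : Prop where
  init_nonneg : ∀ v, 0 ≤ S.init v
  init_dest : ∀ v ∈ S.dest, S.init v = 0
  feasible_bound : ∀ t, ∀ r ∈ S.feasible t, ∀ u v,
    r u v = 0 ∨ (Rmin ≤ r u v ∧ r u v ≤ Rmax)
  size_bound : ∀ t k, Rmin ≤ S.size t k
  injected_bound : ∀ t v, S.injected t v ≤ Rmax
  rate_mem : ∀ t, S.rate t ∈ S.feasible t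
  send_nonneg : ∀ t u v, 0 ≤ S.send t u v
  send_le_rate : ∀ t u v, S.send t u v ≤ S.rate t u v
  send_le_queue : ∀ t u, ∑ v, S.send t u v ≤ S.queue t u

/-- `Γ p t u v` is the part of the transmission from `u` to `v` at time `t` that is assigned to the
packet `p`. Only transmissions in the window `[t_p, t_p + ω - 1]` are assigned to a packet injected
at time `t_p`, and at most what is transmitted on a link is assigned to all packets together. -/
structure IsAssignment (S : QueuePlay n) (ω : ℕ)
    (Γ : S.Packet → ℕ → Fin n → Fin n → ℝ) : Prop where
  nonneg : ∀ p t u v, 0 ≤ Γ p t u v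
  window : ∀ p t u v, ¬ (p.1 ≤ t ∧ t < p.1 + ω) → Γ p t u v = 0
  total_le : ∀ t u v,
    ∑ t₀ ∈ Finset.range (t + 1), ∑ k : Fin (S.count t₀), Γ ⟨t₀, k⟩ t u v ≤ S.send t u v

/-- The change of the potential `∑ v, (q v) ^ 2` that is caused by the transmission from `u` to `v`
at time `t`. -/
noncomputable def linkChange (S : QueuePlay n) (t : ℕ) (u v : Fin n) : ℝ :=
  ((S.queue t v + S.send t u v) ^ 2 - S.queue t v ^ 2) +
    ((S.queue t u - S.send t u v) ^ 2 - S.queue t u ^ 2)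

/-- The height, at the time of the injection, of the queue into which `p` is injected. -/
noncomputable def height (S : QueuePlay n) (p : S.Packet) : ℝ :=
  S.queue p.1 (S.source p.1 p.2)

/-- The sum of the potential changes due to the packet `p`: the change due to its injection, and for
each assigned partial transmission the proportional share of the change due to that transmission. -/
noncomputable def packetChange (S : QueuePlay n) (ω : ℕ)
    (Γ : S.Packet → ℕ → Fin n → Fin n → ℝ) (p : S.Packet) : ℝ :=
  ((S.height p + S.size p.1 p.2) ^ 2 - S.height p ^ 2) +
    ∑ t ∈ Finset.Ico p.1 (p.1 + ω), ∑ u, ∑ v, Γ p t u v / S.send t u v * S.linkChange t u v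

/-- A packet is bad if the sum of the potential changes due to it is at least
`-(ε / (1 - ε / 2)) * ℓ_p * q + C + 1`, where `q` is the height of the queue it is injected into. -/
def IsBad (S : QueuePlay n) (ω : ℕ) (ε C : ℝ)
    (Γ : S.Packet → ℕ → Fin n → Fin n → ℝ) (p : S.Packet) : Prop :=
  -(ε / (1 - ε / 2)) * S.size p.1 p.2 * S.height p + C + 1 ≤ S.packetChange ω Γ p

/-- The play is one against an `(ω, ε, b)`-adversary: for a suitable assignment of partial
transmissions of the algorithm, at most `b` packets are bad over all time. -/
def IsAdversarial (S : QueuePlay n) (ω : ℕ) (ε C : ℝ) (b : ℕ) : Prop :=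
  ∃ Γ : S.Packet → ℕ → Fin n → Fin n → ℝ,
    S.IsAssignment ω Γ ∧ {p : S.Packet | S.IsBad ω ε C Γ p}.encard ≤ b

/-- Data only moves from a taller queue to a shorter queue. -/
def MovesDownhill (S : QueuePlay n) : Prop :=
  ∀ t u v, 0 < S.send t u v → S.queue t v < S.queue t u

/-- The queue sizes stay bounded over all time. -/
def Stable (S : QueuePlay n) : Prop :=
  ∃ B : ℝ, ∀ t v, S.queue t v ≤ B

end QueuePlay

/-! The proof keeps the sum of squares over every set `A` of `k` queues below the cap `levelSum X M
k`, whose increments in `k` decrease geometrically. Singletons then give the bound `X / M`. The caps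
make a set near its own cap isolated: comparing it with the caps of `A` minus a queue and of `A`
plus a queue shows that each member of `A` is at least `M / 4` times as tall as each other queue
(`separated_of_levelSum`). Since data moves downhill, nothing is then sent into `A`.

While `A` is isolated, a packet that is not bad and is injected into `A` lowers the sum over `A`, to
first order, in proportion to the height of `A` (`packet_drift`). Large `M` makes the error from the
low queues negligible, and large `X` pays for the second-order errors in the `ω` steps of the
window. Only boundedly many packets escape this accounting: the bad ones and those whose window is
not yet over.

The delicate steps are those that no packet pays for. A downhill transmission may overshoot and
raise the sum of squares, and this can happen arbitrarily often. A majorization argument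
(`sum_sq_le_of_overshoot`) bounds the total rise over such an interval independently of its length.
Altogether (`sum_sq_drift`) an isolated set gains at most an amount affine in `X`, while the margin
near its cap is quadratic in `X`; hence no cap is ever exceeded (`sum_sq_le_levelSum`). -/

/-! ### Majorization and the bounded effect of overshooting -/

open Finset in
/-- Abel summation: a sequence with nonnegative partial sums pairs nonnegatively with a nonnegative
antitone sequence. -/
theorem sum_mul_nonneg_of_partial_sums {m : ℕ} {d y : ℕ → ℝ}
    (hd : ∀ j ≤ m, 0 ≤ ∑ i ∈ range j, d i) (hy : ∀ i, i + 1 < m → y (i + 1) ≤ y i)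
    (hy0 : ∀ i < m, 0 ≤ y i) : 0 ≤ ∑ i ∈ range m, d i * y i := by
  have key : ∀ j, j + 1 ≤ m →
      (∑ i ∈ range (j + 1), d i) * y j ≤ ∑ i ∈ range (j + 1), d i * y i := by
    intro j
    induction j with
    | zero => intro _; simp
    | succ j ih =>
      intro hj
      have h1 := ih (by omega)
      have h2 := mul_le_mul_of_nonneg_left (hy j (by omega)) (hd (j + 1) (by omega))
      rw [sum_range_succ, sum_range_succ (fun i => d i * y i)]
      linarith
  rcases m with _ | m
  · simp
  · exact (mul_nonneg (hd _ le_rfl) (hy0 m (by omega))).trans (key m le_rfl)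

open Finset in
/-- Weak majorization by the increments of `F` bounds sums of squares. -/
theorem sum_sq_le_of_partial_sums_le {m : ℕ} {x y : ℕ → ℝ}
    (hxy : ∀ j ≤ m, ∑ i ∈ range j, y i ≤ ∑ i ∈ range j, x i)
    (hy : ∀ i, i + 1 < m → y (i + 1) ≤ y i) (hy0 : ∀ i < m, 0 ≤ y i) :
    ∑ i ∈ range m, y i ^ 2 ≤ ∑ i ∈ range m, x i ^ 2 := by
  have h := sum_mul_nonneg_of_partial_sums (d := fun i => x i - y i)
    (fun j hj => by rw [sum_sub_distrib]; linarith [hxy j hj]) hy hy0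
  have h2 : ∑ i ∈ range m, (2 * ((x i - y i) * y i)) ≤ ∑ i ∈ range m, (x i ^ 2 - y i ^ 2) :=
    sum_le_sum fun i _ => by nlinarith [sq_nonneg (x i - y i)]
  rw [← mul_sum, sum_sub_distrib] at h2
  linarith

/-- Every vector is majorized by a vector whose consecutive entries drop by at least `D` and whose
sum of squares is larger by at most a constant. -/
theorem exists_separated_majorant_fin (m : ℕ) (q : EuclideanSpace ℝ (Fin m)) (D : ℝ) :
    ∃ x : EuclideanSpace ℝ (Fin m),
      (∀ i j : Fin m, (i : ℕ) + 1 = j → x j + D ≤ x i) ∧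
      (∀ j : ℕ, 0 ≤ ∑ i, (x i - q i) * (if (i : ℕ) < j then 1 else 0)) ∧
      ∑ i, x i ^ 2 ≤ ∑ i, q i ^ 2 + ∑ i : Fin m, (D * i) ^ 2 := by
  -- The majorant is the projection of `q` onto the closed convex set `K`; both of its properties
  -- come from testing the variational inequality at suitable points of `K`.
  let K : Set (EuclideanSpace ℝ (Fin m)) := {x | ∀ i j : Fin m, (i : ℕ) + 1 = j → x j + D ≤ x i}
  let z : EuclideanSpace ℝ (Fin m) := WithLp.toLp 2 fun i => -(D * i)
  have hz : z ∈ K := by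
    intro i j hij
    change -(D * (j : ℕ)) + D ≤ -(D * (i : ℕ))
    rw [← hij]; push_cast; linarith
  have hKc : IsClosed K := by
    have : K = ⋂ i : Fin m, ⋂ j : Fin m, {x | (i : ℕ) + 1 = j → x j + D ≤ x i} := by
      ext x; simp [K]
    rw [this]
    refine isClosed_iInter fun i => isClosed_iInter fun j => ?_
    by_cases h : (i : ℕ) + 1 = j
    · simp only [h, true_imp_iff]
      exact isClosed_le (by fun_prop) (by fun_prop)
    · simp [h]
  have hKconv : Convex ℝ K := by
    intro x hx y hy a b ha hb hab i j hij
    have h1 := mul_le_mul_of_nonneg_left (hx i j hij) ha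
    have h2 := mul_le_mul_of_nonneg_left (hy i j hij) hb
    simp only [PiLp.add_apply, PiLp.smul_apply, smul_eq_mul]
    have : D = a * D + b * D := by rw [← add_mul, hab, one_mul]
    linarith
  obtain ⟨x, hxK, hx⟩ := exists_norm_eq_iInf_of_complete_convex ⟨z, hz⟩ hKc.isComplete hKconv q
  have hvar := (norm_eq_iInf_iff_real_inner_le_zero hKconv hxK).1 hx
  have hvar' : ∀ w ∈ K, 0 ≤ ∑ i, (x i - q i) * (w i - x i) := by
    intro w hw
    have h := hvar w hw
    rw [PiLp.inner_apply] at h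
    have : ∑ i, (x i - q i) * (w i - x i) = - ∑ i, inner ℝ ((q - x) i) ((w - x) i) := by
      rw [← Finset.sum_neg_distrib]
      refine Finset.sum_congr rfl fun i _ => ?_
      simp
      ring
    rw [this]; linarith
  refine ⟨x, hxK, fun j => ?_, ?_⟩
  -- Raising the first `j` entries by one can only widen gaps, so the test point stays in `K`.
  · have h := hvar' (x + WithLp.toLp 2 fun i : Fin m => if (i : ℕ) < j then 1 else 0) ?_
    · simpa using h
    · intro i k hik
      have h1 := hxK i k hik
      simp only [PiLp.add_apply]
      split_ifs <;> first | omega | linarith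
  -- The test point `z` has gaps exactly `D`; the slack in the termwise bound is the square `(x i -
  -- q i - z i) ^ 2`.
  · have h := hvar' z hz
    have h2 : ∑ i, (2 * ((x i - q i) * (z i - x i))) ≤
        ∑ i, (q i ^ 2 + (D * (i : ℕ)) ^ 2 - x i ^ 2) := by
      refine Finset.sum_le_sum fun i _ => ?_
      have : z i = -(D * (i : ℕ)) := rfl
      rw [this]
      nlinarith [sq_nonneg (x i - q i + D * (i : ℕ))]
    rw [← Finset.mul_sum, Finset.sum_sub_distrib, Finset.sum_add_distrib] at h2
    linarith

open Finset in
theorem exists_separated_majorant (m : ℕ) (q : ℕ → ℝ) (D : ℝ) :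
    ∃ x : ℕ → ℝ, (∀ i, i + 1 < m → x (i + 1) + D ≤ x i) ∧
      (∀ j ≤ m, ∑ i ∈ range j, q i ≤ ∑ i ∈ range j, x i) ∧
      ∑ i ∈ range m, x i ^ 2 ≤ ∑ i ∈ range m, q i ^ 2 + ∑ i ∈ range m, (D * i) ^ 2 := by
  obtain ⟨x, h1, h2, h3⟩ := exists_separated_majorant_fin m (WithLp.toLp 2 fun i => q i) D
  let y : ℕ → ℝ := fun i => if h : i < m then x ⟨i, h⟩ else 0
  have hy : ∀ i : Fin m, y i = x i := fun i => by simp [y]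
  refine ⟨y, fun i hi => ?_, fun j hj => ?_, ?_⟩
  · have := h1 ⟨i, by omega⟩ ⟨i + 1, hi⟩ rfl
    rwa [← hy, ← hy] at this
  · have h := h2 j
    have e : ∑ i, (x i - q i) * (if (i : ℕ) < j then 1 else 0) =
        ∑ i ∈ range m, (y i - q i) * (if i < j then 1 else 0) := by
      rw [← Fin.sum_univ_eq_sum_range (fun i => (y i - q i) * (if i < j then 1 else 0))]
      simp only [hy]
    change 0 ≤ ∑ i, (x i - q i) * (if (i : ℕ) < j then 1 else 0) at h
    rw [e] at h
    have e2 : ∑ i ∈ range m, (y i - q i) * (if i < j then 1 else 0) =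
        ∑ i ∈ range j, (y i - q i) := by
      simp only [mul_ite, mul_one, mul_zero]
      rw [← sum_filter]
      congr 1
      ext i; simp; omega
    rw [e2, sum_sub_distrib] at h
    linarith
  · rw [← Fin.sum_univ_eq_sum_range (fun i => y i ^ 2), ← Fin.sum_univ_eq_sum_range (fun i => q i ^ 2),
      ← Fin.sum_univ_eq_sum_range (fun i => (D * (i : ℝ)) ^ 2)]
    simpa only [hy] using h3

open Finset in
/-- A finite set can be enumerated in the order of decreasing values. -/
theorem exists_antitone_enumeration {ι : Type*} [Nonempty ι] [DecidableEq ι] (f : ι → ℝ)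
    (A : Finset ι) :
    ∃ e : ℕ → ι, (range #A).image e = A ∧ Set.InjOn e (range #A) ∧
      ∀ i j, i ≤ j → j < #A → f (e j) ≤ f (e i) := by
  induction A using Finset.induction_on_min_value f with
  | empty => exact ⟨fun _ => Classical.arbitrary ι, by simp, by simp, by simp⟩
  | insert a s ha hmin ih =>
    obtain ⟨e, h1, h2, h3⟩ := ih
    have hmem : ∀ i < #s, e i ∈ s := fun i hi => by
      rw [← h1]; exact mem_image_of_mem _ (mem_range.2 hi)
    rw [card_insert_of_notMem ha]
    refine ⟨fun i => if i < #s then e i else a, ?_, ?_, ?_⟩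
    · rw [range_add_one, image_insert]
      simp only [lt_irrefl, if_false]
      congr 1
      conv_rhs => rw [← h1]
      exact image_congr fun i hi => by simp [mem_range.1 (mem_coe.1 hi)]
    · intro i hi j hj hij
      simp only [coe_range, Set.mem_Iio] at hi hj
      dsimp only at hij
      split_ifs at hij with hi' hj' hj'
      · exact h2 (by simpa using hi') (by simpa using hj') hij
      · exact absurd (hij ▸ hmem i hi') ha
      · exact absurd (hij ▸ hmem j hj') ha
      · omega
    · intro i j hij hj
      dsimp only
      split_ifs with hj' hi' hi'
      · exact h3 i j hij hj'
      · omega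
      · exact hmin _ (hmem i hi')
      · exact le_rfl

open Finset in
-- With `c` the `#B`-th largest value, the sum of `f - c` over `B` is at most the sum of its
-- positive parts over `A`, and only the first `#B` entries contribute to the latter.
theorem sum_le_sum_enumeration {ι : Type*} [DecidableEq ι] {f : ι → ℝ} {A B : Finset ι} {e : ℕ → ι}
    (he : (range #A).image e = A) (hinj : Set.InjOn e (range #A))
    (hanti : ∀ i j, i ≤ j → j < #A → f (e j) ≤ f (e i)) (hB : B ⊆ A) :
    ∑ v ∈ B, f v ≤ ∑ i ∈ range #B, f (e i) := by
  rcases Nat.eq_zero_or_pos #B with h0 | h0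
  · rw [card_eq_zero.1 h0]; simp
  have hBA := card_le_card hB
  set c := f (e (#B - 1)) with hc
  have h1 : ∑ v ∈ B, (f v - c) ≤ ∑ v ∈ A, max (f v - c) 0 :=
    (sum_le_sum fun v _ => le_max_left _ _).trans
      (sum_le_sum_of_subset_of_nonneg hB fun _ _ _ => le_max_right _ _)
  have h2 : ∑ v ∈ A, max (f v - c) 0 = ∑ i ∈ range #A, max (f (e i) - c) 0 := by
    conv_lhs => rw [← he]
    exact sum_image hinj
  have h3 : ∑ i ∈ range #A, max (f (e i) - c) 0 = ∑ i ∈ range #B, max (f (e i) - c) 0 := by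
    symm
    refine sum_subset (range_subset_range.2 hBA) fun i hi hi' => ?_
    simp only [mem_range, not_lt] at hi hi'
    exact max_eq_right (sub_nonpos.2 (hanti _ _ (by omega) hi))
  have h4 : ∑ i ∈ range #B, max (f (e i) - c) 0 = ∑ i ∈ range #B, (f (e i) - c) := by
    refine sum_congr rfl fun i hi => max_eq_left (sub_nonneg.2 ?_)
    have := mem_range.1 hi
    exact hanti _ _ (by omega) (by omega)
  rw [h2, h3, h4, sum_sub_distrib, sum_sub_distrib] at h1
  simp only [sum_const, card_range] at h1
  linarith

open Finset in
/-- If the sum over a set `B ⊆ A` can only increase, and by at most `D`, when some element of `B` is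
dominated by an element of `A` outside `B`, then the sum of squares over `A` never increases by
more than a constant. -/
theorem sum_sq_le_of_overshoot {ι : Type*} [DecidableEq ι] (A : Finset ι) (q : ℕ → ι → ℝ) {D : ℝ}
    {t₁ t₂ : ℕ} (ht : t₁ ≤ t₂) (hq : ∀ t v, 0 ≤ q t v)
    (hstep : ∀ t, t₁ ≤ t → t < t₂ → ∀ B ⊆ A, ∑ v ∈ B, q (t + 1) v ≤ ∑ v ∈ B, q t v ∨
      ∃ v ∈ B, ∃ u ∈ A, u ∉ B ∧ q t v ≤ q t u ∧
        ∑ v ∈ B, q (t + 1) v ≤ ∑ v ∈ B, q t v + D) :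
    ∑ v ∈ A, q t₂ v ^ 2 ≤ ∑ v ∈ A, q t₁ v ^ 2 + ∑ i ∈ range #A, (2 * D * i) ^ 2 := by
  rcases A.eq_empty_or_nonempty with rfl | ⟨a, -⟩
  · simp
  have : Nonempty ι := ⟨a⟩
  obtain ⟨e, he, hinj, hanti⟩ := exists_antitone_enumeration (q t₁) A
  obtain ⟨x, hx1, hx2, hx3⟩ := exists_separated_majorant #A (fun i => q t₁ (e i)) (2 * D)
  -- This invariant involves only the fixed vector `x`, so it can be propagated over arbitrarily
  -- many steps without loss.
  have hull : ∀ t, t₁ ≤ t → t ≤ t₂ → ∀ B ⊆ A, ∑ v ∈ B, q t v ≤ ∑ i ∈ range #B, x i := by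
    intro t ht1
    induction t, ht1 using Nat.le_induction with
    | base =>
      intro _ B hB
      exact (sum_le_sum_enumeration he hinj hanti hB).trans (hx2 _ (card_le_card hB))
    | succ t ht1 ih =>
      intro ht2 B hB
      have ih := ih (by omega)
      rcases hstep t ht1 (by omega) B hB with h | ⟨v, hv, u, hu, huB, hvu, h⟩
      · exact h.trans (ih B hB)
      -- Since `u` is at least as large as `v`, twice the sum over `B` is at most the sum over `B ∪
      -- {u}` plus that over `B \ {v}`. The gap `2 * D` in `x` therefore leaves room `D` below the
      -- bound for `B`, which absorbs the step.
      · have h1 := ih (insert u B) (insert_subset hu hB)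
        have h2 := ih (B.erase v) ((erase_subset _ _).trans hB)
        have hpos : 0 < #B := card_pos.2 ⟨v, hv⟩
        have hlt : #B < #A := card_lt_card ⟨hB, fun hAB => huB (hAB hu)⟩
        rw [sum_insert huB, card_insert_of_notMem huB, sum_range_succ] at h1
        rw [card_erase_of_mem hv] at h2
        have h3 := add_sum_erase B (q t) hv
        obtain ⟨m, hm⟩ : ∃ m, #B = m + 1 := ⟨#B - 1, by omega⟩
        have h4 := hx1 m (by omega)
        rw [hm] at h1 h2 ⊢
        simp only [Nat.add_sub_cancel] at h2
        rw [sum_range_succ] at h1 ⊢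
        linarith
  obtain ⟨e', he', hinj', hanti'⟩ := exists_antitone_enumeration (q t₂) A
  have hsum : ∀ (e : ℕ → ι), (range #A).image e = A → Set.InjOn e (range #A) →
      ∀ f : ι → ℝ, ∑ v ∈ A, f v = ∑ i ∈ range #A, f (e i) := by
    intro e he hinj f
    conv_lhs => rw [← he]
    exact sum_image hinj
  rw [hsum e' he' hinj', hsum e he hinj]
  refine le_trans (sum_sq_le_of_partial_sums_le (fun j hj => ?_)
    (fun i hi => hanti' _ _ (by omega) hi) (fun i _ => hq _ _)) hx3
  have hsub : range j ⊆ range #A := range_subset_range.2 hj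
  have hinjj : Set.InjOn e' (range j) := hinj'.mono (by exact_mod_cast hsub)
  have h := hull t₂ ht le_rfl ((range j).image e') (by
    conv_rhs => rw [← he']
    exact image_subset_image hsub)
  rwa [card_image_of_injOn hinjj, card_range, sum_image hinjj] at h

/-! ### Splitting time into active and quiet steps -/

open Finset in
/-- If a quantity increases by at most `g t` in an active step `t`, and by at most `K` over each
interval without active steps, then its total increase is controlled by the active steps. -/
theorem le_add_sum_active {Q g : ℕ → ℝ} {K : ℝ} {t₁ t₂ : ℕ} {Act : Finset ℕ} (ht : t₁ ≤ t₂)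
    (hact : ∀ t ∈ Act, t₁ ≤ t → t < t₂ → Q (t + 1) ≤ Q t + g t)
    (hquiet : ∀ s t, t₁ ≤ s → s ≤ t → t ≤ t₂ → (∀ r ∈ Act, s ≤ r → ¬ r < t) → Q t ≤ Q s + K) :
    Q t₂ ≤ Q t₁ + K + ∑ t ∈ Act with t₁ ≤ t ∧ t < t₂, (g t + K) := by
  induction t₂ using Nat.strong_induction_on with
  | _ T ih =>
    by_cases hne : (Act.filter fun t => t₁ ≤ t ∧ t < T).Nonempty
    -- Split at the last active step: the induction hypothesis up to `r`, the step `r` itself, then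
    -- one quiet interval.
    · set r := (Act.filter fun t => t₁ ≤ t ∧ t < T).max' hne
      have hr := mem_filter.1 (max'_mem _ hne)
      have hmax : ∀ s ∈ Act, t₁ ≤ s → s < T → s ≤ r := fun s hs h1 h2 =>
        le_max' _ _ (mem_filter.2 ⟨hs, h1, h2⟩)
      have h1 := hquiet (r + 1) T (by omega) (by omega) le_rfl fun s hs h1 h2 => by
        have := hmax s hs (by omega) h2
        omega
      have h2 := hact r hr.1 hr.2.1 hr.2.2
      have h3 := ih r hr.2.2 hr.2.1 (fun t ht h h' => hact t ht h (by omega))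
        (fun s t h1 h2 h3 => hquiet s t h1 h2 (by omega))
      have h4 : Act.filter (fun t => t₁ ≤ t ∧ t < T) =
          insert r (Act.filter fun t => t₁ ≤ t ∧ t < r) := by
        ext s
        simp only [mem_filter, mem_insert]
        constructor
        · rintro ⟨hs, h1, h2⟩
          rcases (hmax s hs h1 h2).eq_or_lt with h | h
          · exact Or.inl h
          · exact Or.inr ⟨hs, h1, h⟩
        · rintro (rfl | ⟨hs, h1, h2⟩)
          · exact hr
          · exact ⟨hs, h1, h2.trans hr.2.2⟩
      rw [h4, sum_insert (by simp)]
      linarith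
    · rw [not_nonempty_iff_eq_empty] at hne
      rw [hne, sum_empty, add_zero]
      refine hquiet t₁ T le_rfl ht le_rfl fun r hr h1 h2 => ?_
      exact absurd (mem_filter.2 ⟨hr, h1, h2⟩) (hne ▸ notMem_empty r)

/-! ### One-step estimates and quiet intervals -/

namespace QueuePlay

variable {n : ℕ} {S : QueuePlay n} {Rmin Rmax R : ℝ}

namespace Admissible

theorem size_pos (h : S.Admissible Rmin Rmax) (hmin : 0 < Rmin) (t : ℕ) (k : Fin (S.count t)) :
    0 < S.size t k := hmin.trans_le (h.size_bound t k)

theorem injected_nonneg (h : S.Admissible Rmin Rmax) (hmin : 0 < Rmin) (t : ℕ) (v : Fin n) :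
    0 ≤ S.injected t v :=
  Finset.sum_nonneg fun k _ => by split_ifs <;> [exact (h.size_pos hmin t k).le; exact le_rfl]

theorem size_le (h : S.Admissible Rmin Rmax) (hmin : 0 < Rmin) (hR : Rmax ≤ R) (t : ℕ)
    (k : Fin (S.count t)) : S.size t k ≤ R := by
  refine le_trans ?_ ((h.injected_bound t (S.source t k)).trans hR)
  have := Finset.single_le_sum
    (f := fun j => if S.source t j = S.source t k then S.size t j else 0)
    (fun j _ => by
      split_ifs <;> [exact (h.size_pos hmin t j).le; exact le_rfl]) (Finset.mem_univ k)
  simpa [injected] using this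

theorem send_le (h : S.Admissible Rmin Rmax) (hR : Rmax ≤ R) (hR0 : 0 ≤ R) (t : ℕ) (u v : Fin n) :
    S.send t u v ≤ R := by
  refine (h.send_le_rate t u v).trans ?_
  rcases h.feasible_bound t _ (h.rate_mem t) u v with h0 | ⟨-, h1⟩
  · rwa [h0]
  · exact h1.trans hR

theorem queue_nonneg (h : S.Admissible Rmin Rmax) (hmin : 0 < Rmin) (t : ℕ) (v : Fin n) :
    0 ≤ S.queue t v := by
  cases t with
  | zero => exact h.init_nonneg v
  | succ t =>
    rw [queue]
    split_ifs
    · exact le_rfl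
    · have h1 := h.send_le_queue t v
      have h2 := h.injected_nonneg hmin t v
      have h3 : 0 ≤ ∑ u, S.send t u v := Finset.sum_nonneg fun u _ => h.send_nonneg t u v
      linarith

theorem queue_of_mem_dest (h : S.Admissible Rmin Rmax) (t : ℕ) {v : Fin n} (hv : v ∈ S.dest) :
    S.queue t v = 0 := by
  cases t with
  | zero => exact h.init_dest v hv
  | succ t => rw [queue, if_pos hv]

theorem queue_succ (h : S.Admissible Rmin Rmax) {t : ℕ} {v : Fin n} (hv : 0 < S.queue t v) :
    S.queue (t + 1) v =
      S.queue t v - ∑ u, S.send t v u + ∑ u, S.send t u v + S.injected t v := by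
  rw [queue, if_neg fun hd => hv.ne' (h.queue_of_mem_dest t hd)]

theorem sum_send_in_le (h : S.Admissible Rmin Rmax) (hR : Rmax ≤ R) (hR0 : 0 ≤ R) (t : ℕ)
    (v : Fin n) : ∑ u, S.send t u v ≤ n * R := by
  have := Finset.sum_le_card_nsmul Finset.univ (fun u => S.send t u v) R
    fun u _ => h.send_le hR hR0 t u v
  simpa using this

theorem sum_send_out_le (h : S.Admissible Rmin Rmax) (hR : Rmax ≤ R) (hR0 : 0 ≤ R) (t : ℕ)
    (v : Fin n) : ∑ u, S.send t v u ≤ n * R := by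
  have := Finset.sum_le_card_nsmul Finset.univ (fun u => S.send t v u) R
    fun u _ => h.send_le hR hR0 t v u
  simpa using this

theorem queue_succ_le (h : S.Admissible Rmin Rmax) (hmin : 0 < Rmin) (hR : Rmax ≤ R) (hR0 : 0 ≤ R)
    (t : ℕ) (v : Fin n) : S.queue (t + 1) v ≤ S.queue t v + (n + 1) * R := by
  rw [queue]
  split_ifs
  · have := h.queue_nonneg hmin t v
    positivity
  · have h1 : 0 ≤ ∑ u, S.send t v u := Finset.sum_nonneg fun u _ => h.send_nonneg t v u
    have h2 := h.sum_send_in_le hR hR0 t v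
    have h3 := (h.injected_bound t v).trans hR
    linarith

theorem count_le (h : S.Admissible Rmin Rmax) (hmin : 0 < Rmin) (hR : Rmax ≤ R) (t : ℕ) :
    (S.count t : ℝ) ≤ n * R / Rmin := by
  rw [le_div_iff₀ hmin]
  have h1 : ∑ v, S.injected t v = ∑ k, S.size t k := by
    simp only [injected]
    rw [Finset.sum_comm]
    simp
  have h2 := Finset.card_nsmul_le_sum Finset.univ (S.size t) Rmin fun k _ => h.size_bound t k
  have h3 := Finset.sum_le_card_nsmul Finset.univ (S.injected t) R
    fun v _ => (h.injected_bound t v).trans hR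
  simp only [Finset.card_univ, Fintype.card_fin, nsmul_eq_mul] at h2 h3
  linarith

end Admissible

/-- The queue sizes on `A`, extended by zero. -/
noncomputable def cutoff (S : QueuePlay n) (A : Finset (Fin n)) (t : ℕ) (v : Fin n) : ℝ :=
  if v ∈ A then S.queue t v else 0

theorem sum_queue_mul_injected (S : QueuePlay n) (A : Finset (Fin n)) (t : ℕ) :
    ∑ v ∈ A, S.queue t v * S.injected t v =
      ∑ k, if S.source t k ∈ A then S.size t k * S.height ⟨t, k⟩ else 0 := by
  simp only [injected, Finset.mul_sum]
  rw [Finset.sum_comm]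
  refine Finset.sum_congr rfl fun k _ => ?_
  simp only [mul_ite, mul_zero, Finset.sum_ite_eq, height]
  split_ifs <;> ring

theorem sum_cutoff_mul_net_inflow (S : QueuePlay n) (A : Finset (Fin n)) (t : ℕ) :
    ∑ v ∈ A, 2 * S.queue t v * (∑ u, S.send t u v - ∑ u, S.send t v u) =
      ∑ u, ∑ v, 2 * S.send t u v * (S.cutoff A t v - S.cutoff A t u) := by
  have h1 : ∑ v ∈ A, 2 * S.queue t v * (∑ u, S.send t u v - ∑ u, S.send t v u) =
      ∑ v, 2 * S.cutoff A t v * (∑ u, S.send t u v - ∑ u, S.send t v u) := by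
    rw [← Finset.sum_subset (Finset.subset_univ A)]
    · exact Finset.sum_congr rfl fun v hv => by rw [cutoff, if_pos hv]
    · intro v _ hv
      rw [cutoff, if_neg hv]; ring
  rw [h1]
  simp only [mul_sub, Finset.sum_sub_distrib, Finset.mul_sum]
  congr 1
  · rw [Finset.sum_comm]
    exact Finset.sum_congr rfl fun u _ => Finset.sum_congr rfl fun v _ => by ring
  · exact Finset.sum_congr rfl fun u _ => Finset.sum_congr rfl fun v _ => by ring

/-- Expand the square: the linear part is the first-order effect of transmissions and injections,
and the net change of one queue is at most `(n + 1) * R` in absolute value. Positivity on `A`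
excludes destinations, so the recursion is exact there. -/
theorem Admissible.sum_sq_succ_le (h : S.Admissible Rmin Rmax) (hmin : 0 < Rmin) (hR : Rmax ≤ R)
    (hR0 : 0 ≤ R) {A : Finset (Fin n)} {t : ℕ} (hA : ∀ v ∈ A, 0 < S.queue t v) :
    ∑ v ∈ A, S.queue (t + 1) v ^ 2 ≤ ∑ v ∈ A, S.queue t v ^ 2 +
      (∑ u, ∑ v, 2 * S.send t u v * (S.cutoff A t v - S.cutoff A t u) +
        2 * (∑ k, if S.source t k ∈ A then S.size t k * S.height ⟨t, k⟩ else 0) +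
        n * ((n + 1) * R) ^ 2) := by
  have h1 : ∀ v ∈ A, S.queue (t + 1) v ^ 2 ≤ S.queue t v ^ 2 +
      2 * S.queue t v * (∑ u, S.send t u v - ∑ u, S.send t v u) +
        2 * (S.queue t v * S.injected t v) + ((n + 1) * R) ^ 2 := by
    intro v hv
    rw [h.queue_succ (hA v hv)]
    have a1 : 0 ≤ ∑ u, S.send t v u := Finset.sum_nonneg fun u _ => h.send_nonneg t v u
    have a2 : 0 ≤ ∑ u, S.send t u v := Finset.sum_nonneg fun u _ => h.send_nonneg t u v
    have a3 := h.sum_send_in_le hR hR0 t v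
    have a4 := h.sum_send_out_le hR hR0 t v
    have a5 := (h.injected_bound t v).trans hR
    have a6 := h.injected_nonneg hmin t v
    have a7 : (∑ u, S.send t u v - ∑ u, S.send t v u + S.injected t v) ^ 2 ≤ ((n + 1) * R) ^ 2 := by
      apply sq_le_sq'
      · linarith
      · linarith
    nlinarith [a7]
  have h2 := Finset.sum_le_sum h1
  rw [Finset.sum_add_distrib, Finset.sum_add_distrib, Finset.sum_add_distrib,
    sum_cutoff_mul_net_inflow, ← Finset.mul_sum, sum_queue_mul_injected, Finset.sum_const,
    nsmul_eq_mul] at h2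
  have h3 : (A.card : ℝ) * ((n + 1) * R) ^ 2 ≤ n * ((n + 1) * R) ^ 2 := by
    have : (A.card : ℝ) ≤ n := by
      exact_mod_cast (Finset.card_le_univ A).trans_eq (Fintype.card_fin n)
    gcongr
  linarith

/-- The constant by which downhill transmissions can increase a sum of squares. -/
noncomputable def overshoot (n : ℕ) (R : ℝ) : ℝ :=
  ∑ i ∈ Finset.range n, (2 * (n * (n * R)) * i) ^ 2

theorem overshoot_nonneg (n : ℕ) (R : ℝ) : 0 ≤ overshoot n R :=
  Finset.sum_nonneg fun _ _ => sq_nonneg _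

/-- Without injections the sum over `B ⊆ A` grows only if some queue outside `B` sends into `B`.
Downhill motion and the gap around `A` force that sender to be a taller queue in `A \ B`, which is
the hypothesis of `sum_sq_le_of_overshoot`. -/
theorem Admissible.sum_sq_le_of_no_injection (h : S.Admissible Rmin Rmax) (hmin : 0 < Rmin)
    (hR : Rmax ≤ R) (hR0 : 0 ≤ R) (hdown : S.MovesDownhill) {A : Finset (Fin n)} {t₁ t₂ : ℕ}
    (ht : t₁ ≤ t₂) (hA : ∀ t, t₁ ≤ t → t < t₂ → ∀ v ∈ A, 0 < S.queue t v)
    (hgap : ∀ t, t₁ ≤ t → t < t₂ → ∀ v ∈ A, ∀ u ∉ A, S.queue t u ≤ S.queue t v)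
    (hinj : ∀ t, t₁ ≤ t → t < t₂ → ∀ v ∈ A, S.injected t v = 0) :
    ∑ v ∈ A, S.queue t₂ v ^ 2 ≤ ∑ v ∈ A, S.queue t₁ v ^ 2 + overshoot n R := by
  have hcard : A.card ≤ n := (Finset.card_le_univ A).trans_eq (Fintype.card_fin n)
  refine (sum_sq_le_of_overshoot A S.queue (D := n * (n * R)) ht
    (fun t v => h.queue_nonneg hmin t v) fun t h1 h2 B hB => ?_).trans ?_
  -- Transmissions inside `B` cancel, and those leaving `B` only help.
  · have hcross : ∑ v ∈ B, (∑ u, S.send t u v - ∑ u, S.send t v u) ≤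
        ∑ v ∈ B, ∑ u ∈ Bᶜ, S.send t u v := by
      have e1 : ∀ v, ∑ u, S.send t u v = ∑ u ∈ B, S.send t u v + ∑ u ∈ Bᶜ, S.send t u v :=
        fun v => (Finset.sum_add_sum_compl B _).symm
      have e2 : ∑ v ∈ B, ∑ u ∈ B, S.send t v u ≤ ∑ v ∈ B, ∑ u, S.send t v u :=
        Finset.sum_le_sum fun v _ => Finset.sum_le_sum_of_subset_of_nonneg (Finset.subset_univ _)
          fun u _ _ => h.send_nonneg t v u
      rw [Finset.sum_sub_distrib]
      simp only [e1 _]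
      rw [Finset.sum_add_distrib, Finset.sum_comm (s := B) (t := B)]
      have e3 : ∑ v ∈ B, ∑ u, S.send t v u =
          ∑ v ∈ B, (∑ u ∈ B, S.send t v u + ∑ u ∈ Bᶜ, S.send t v u) :=
        Finset.sum_congr rfl fun v _ => (Finset.sum_add_sum_compl B _).symm
      linarith
    have hsucc : ∑ v ∈ B, S.queue (t + 1) v = ∑ v ∈ B, S.queue t v +
        ∑ v ∈ B, (∑ u, S.send t u v - ∑ u, S.send t v u) := by
      rw [← Finset.sum_add_distrib]
      refine Finset.sum_congr rfl fun v hv => ?_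
      rw [h.queue_succ (hA t h1 h2 v (hB hv)), hinj t h1 h2 v (hB hv)]
      ring
    by_cases hex : ∃ v ∈ B, ∃ u, u ∉ B ∧ 0 < S.send t u v
    · obtain ⟨v, hv, u, hu, huv⟩ := hex
      have hlt := hdown t u v huv
      refine Or.inr ⟨v, hv, u, ?_, hu, hlt.le, ?_⟩
      · by_contra huA
        exact absurd (hgap t h1 h2 v (hB hv) u huA) (not_le.2 hlt)
      · have b1 : ∑ v ∈ B, ∑ u ∈ Bᶜ, S.send t u v ≤ ∑ v : Fin n, ∑ u, S.send t u v := by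
          refine (Finset.sum_le_sum fun v _ => Finset.sum_le_sum_of_subset_of_nonneg
            (Finset.subset_univ _) fun u _ _ => h.send_nonneg t u v).trans ?_
          exact Finset.sum_le_sum_of_subset_of_nonneg (Finset.subset_univ _)
            fun v _ _ => Finset.sum_nonneg fun u _ => h.send_nonneg t u v
        have b2 : ∑ v : Fin n, ∑ u, S.send t u v ≤ n * (n * R) := by
          have := Finset.sum_le_card_nsmul Finset.univ (fun v => ∑ u, S.send t u v) (n * R)
            fun v _ => h.sum_send_in_le hR hR0 t v
          simpa using this
        linarith
    · push Not at hex
      left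
      have : ∑ v ∈ B, ∑ u ∈ Bᶜ, S.send t u v ≤ 0 :=
        Finset.sum_nonpos fun v hv => Finset.sum_nonpos fun u hu =>
          hex v hv u (Finset.mem_compl.1 hu)
      linarith
  · have := Finset.sum_le_sum_of_subset_of_nonneg (Finset.range_subset_range.2 hcard)
      (f := fun i : ℕ => (2 * ((n : ℝ) * (n * R)) * i) ^ 2) fun _ _ _ => sq_nonneg _
    rw [overshoot]
    linarith

end QueuePlay

/-! ### Drift of the potential over a separated set -/

namespace QueuePlay

variable {n : ℕ} {S : QueuePlay n} {Rmin Rmax R : ℝ} {ω b : ℕ} {ε C : ℝ}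
  {Γ : S.Packet → ℕ → Fin n → Fin n → ℝ}

theorem IsAssignment.sum_le_send (hΓ : S.IsAssignment ω Γ) (G : Finset S.Packet) (t : ℕ)
    (u v : Fin n) : ∑ p ∈ G, Γ p t u v ≤ S.send t u v := by
  refine le_trans ?_ (hΓ.total_le t u v)
  -- Packets injected after `t` are not covered by `total_le`, but their windows have not begun.
  have h1 : ∑ p ∈ G, Γ p t u v = ∑ p ∈ G with p.1 ≤ t, Γ p t u v := by
    rw [Finset.sum_filter]
    refine Finset.sum_congr rfl fun p _ => ?_
    split_ifs with hp
    · rfl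
    · exact hΓ.window p t u v fun hw => hp hw.1
  rw [h1, Finset.sum_sigma']
  refine Finset.sum_le_sum_of_subset_of_nonneg (fun p hp => ?_) fun p _ _ => hΓ.nonneg p t u v
  have := (Finset.mem_filter.1 hp).2
  simp only [Finset.mem_sigma, Finset.mem_range, Finset.mem_univ, and_true]
  omega

theorem IsAssignment.le_send (hΓ : S.IsAssignment ω Γ) (p : S.Packet) (t : ℕ) (u v : Fin n) :
    Γ p t u v ≤ S.send t u v := by
  simpa using hΓ.sum_le_send {p} t u v

/-- Queues in `A` are at least `lo` and at most `top` high, the others at most `hi`. -/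
structure Separated (S : QueuePlay n) (A : Finset (Fin n)) (lo hi top : ℝ) (t : ℕ) : Prop where
  lo_le : ∀ v ∈ A, lo ≤ S.queue t v
  le_top : ∀ v ∈ A, S.queue t v ≤ top
  le_hi : ∀ u ∉ A, S.queue t u ≤ hi

variable {A : Finset (Fin n)} {lo hi top : ℝ}

theorem Separated.send_eq_zero {t : ℕ} (hA : S.Separated A lo hi top t) (hlt : hi < lo)
    (h : S.Admissible Rmin Rmax) (hdown : S.MovesDownhill) {u v : Fin n} (hu : u ∉ A)
    (hv : v ∈ A) : S.send t u v = 0 := by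
  by_contra h0
  have h1 := hdown t u v (lt_of_le_of_ne (h.send_nonneg t u v) (Ne.symm h0))
  linarith [hA.lo_le v hv, hA.le_hi u hu]

/-- Replacing the low queues by zero keeps every actual transmission downhill, so each first-order
term is nonpositive. -/
theorem Separated.cutoff_le {t : ℕ} (hA : S.Separated A lo hi top t) (hlt : hi < lo)
    (hmin : 0 < Rmin) (h : S.Admissible Rmin Rmax) (hdown : S.MovesDownhill) {u v : Fin n}
    (huv : 0 < S.send t u v) : S.cutoff A t v ≤ S.cutoff A t u := by
  have hd := hdown t u v huv
  have h0 := h.queue_nonneg hmin t u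
  rw [cutoff, cutoff]
  split_ifs with hv hu hu
  · exact hd.le
  · exact absurd (hA.send_eq_zero hlt h hdown hu hv) huv.ne'
  · exact h0
  · exact le_rfl

/-- The exact share exceeds its first-order part by a nonnegative quadratic term. Cutting off can
lose something only on links with both ends outside `A`, where the heights are at most `hi`; this
gives the error `2 * R * hi`. -/
theorem Separated.share_le {t : ℕ} (hA : S.Separated A lo hi top t) (hlt : hi < lo) (hhi : 0 ≤ hi)
    (hmin : 0 < Rmin) (hR : Rmax ≤ R) (hR0 : 0 ≤ R) (h : S.Admissible Rmin Rmax)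
    (hdown : S.MovesDownhill) (hΓ : S.IsAssignment ω Γ) (p : S.Packet) (u v : Fin n) :
    2 * Γ p t u v * (S.cutoff A t v - S.cutoff A t u) ≤
      Γ p t u v / S.send t u v * S.linkChange t u v + 2 * R * hi := by
  have hg0 := hΓ.nonneg p t u v
  have hgs := hΓ.le_send p t u v
  rcases (h.send_nonneg t u v).eq_or_lt with hs | hs
  · have : Γ p t u v = 0 := by linarith
    rw [this]
    simpa using by positivity
  have hgR := hgs.trans (h.send_le hR hR0 t u v)
  have e : Γ p t u v / S.send t u v * S.linkChange t u v =
      2 * Γ p t u v * (S.queue t v - S.queue t u) + 2 * (Γ p t u v * S.send t u v) := by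
    rw [linkChange]; field_simp; ring
  rw [e]
  have hgs0 := mul_nonneg hg0 hs.le
  have hRhi := mul_nonneg hR0 hhi
  have hghi := mul_le_mul_of_nonneg_right hgR hhi
  have hv0 := mul_nonneg hg0 (h.queue_nonneg hmin t v)
  rw [cutoff, cutoff]
  split_ifs with hv hu hu
  · linarith
  · exact absurd (hA.send_eq_zero hlt h hdown hu hv) hs.ne'
  · linarith
  · have := mul_le_mul_of_nonneg_left (hA.le_hi u hu) hg0
    linarith

/-- The potential changes on `A`, to first order, that are due to a packet that is not bad. -/
theorem packet_drift (hmin : 0 < Rmin) (hR : Rmax ≤ R) (hR0 : 0 ≤ R) (h : S.Admissible Rmin Rmax)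
    (hdown : S.MovesDownhill) (hΓ : S.IsAssignment ω Γ) (hlt : hi < lo) (hhi : 0 ≤ hi)
    (hε : 0 < ε) (hε2 : ε < 2) {p : S.Packet}
    (hA : ∀ t, p.1 ≤ t → t < p.1 + ω → S.Separated A lo hi top t)
    (hp : ¬ S.IsBad ω ε C Γ p) (hlo : lo ≤ S.height p) :
    2 * (S.size p.1 p.2 * S.height p) + ∑ t ∈ Finset.Ico p.1 (p.1 + ω), ∑ u, ∑ v,
        2 * Γ p t u v * (S.cutoff A t v - S.cutoff A t u) ≤
      -(ε / (1 - ε / 2)) * (Rmin * lo) + C + 1 + ω * (n * (n * (2 * R * hi))) := by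
  have h1 : ∑ t ∈ Finset.Ico p.1 (p.1 + ω), ∑ u, ∑ v,
        2 * Γ p t u v * (S.cutoff A t v - S.cutoff A t u) ≤
      ∑ t ∈ Finset.Ico p.1 (p.1 + ω), ∑ u : Fin n, ∑ v : Fin n,
        (Γ p t u v / S.send t u v * S.linkChange t u v + 2 * R * hi) := by
    refine Finset.sum_le_sum fun t ht => Finset.sum_le_sum fun u _ => Finset.sum_le_sum fun v _ => ?_
    rw [Finset.mem_Ico] at ht
    exact (hA t ht.1 ht.2).share_le hlt hhi hmin hR hR0 h hdown hΓ p u v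
  simp only [Finset.sum_add_distrib, Finset.sum_const, Finset.card_univ, Fintype.card_fin,
    Nat.card_Ico, Nat.add_sub_cancel_left, nsmul_eq_mul] at h1
  rw [IsBad, packetChange, not_le] at hp
  have hε' : 0 < ε / (1 - ε / 2) := div_pos hε (by linarith)
  have h2 : Rmin * lo ≤ S.size p.1 p.2 * S.height p :=
    mul_le_mul (h.size_bound _ _) hlo (by linarith) (h.size_pos hmin _ _).le
  have h3 := mul_le_mul_of_nonneg_left h2 hε'.le
  have h4 : (S.height p + S.size p.1 p.2) ^ 2 - S.height p ^ 2 =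
      2 * (S.size p.1 p.2 * S.height p) + S.size p.1 p.2 ^ 2 := by ring
  nlinarith [sq_nonneg (S.size p.1 p.2)]

/-- All terms on links in use are nonpositive, so keeping only the portions assigned to `G` gives an
upper bound. -/
theorem Separated.sum_send_le {t : ℕ} (hA : S.Separated A lo hi top t) (hlt : hi < lo)
    (hmin : 0 < Rmin) (h : S.Admissible Rmin Rmax) (hdown : S.MovesDownhill)
    (hΓ : S.IsAssignment ω Γ) (G : Finset S.Packet) :
    ∑ u, ∑ v, 2 * S.send t u v * (S.cutoff A t v - S.cutoff A t u) ≤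
      ∑ p ∈ G, ∑ u, ∑ v, 2 * Γ p t u v * (S.cutoff A t v - S.cutoff A t u) := by
  rw [Finset.sum_comm (s := G)]
  refine Finset.sum_le_sum fun u _ => ?_
  rw [Finset.sum_comm (s := G)]
  refine Finset.sum_le_sum fun v _ => ?_
  rw [← Finset.sum_mul, ← Finset.mul_sum]
  have h1 := hΓ.sum_le_send G t u v
  have h2 : 0 ≤ ∑ p ∈ G, Γ p t u v := Finset.sum_nonneg fun p _ => hΓ.nonneg p t u v
  rcases (h.send_nonneg t u v).eq_or_lt with hs | hs
  · have h3 : ∑ p ∈ G, Γ p t u v = 0 := by linarith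
    rw [h3, ← hs]
  · have := mul_nonneg (sub_nonneg.2 h1)
      (sub_nonneg.2 (hA.cutoff_le hlt hmin h hdown hs))
    linarith

/-- A bound on the number of packets that are bad or injected during the last `ω` steps. -/
noncomputable def exceptional (n ω b : ℕ) (Rmin R : ℝ) : ℝ := b + ω * (n * R / Rmin)

/-- The error made in one step by accounting for the transmissions to first order. -/
noncomputable def stepError (n : ℕ) (R : ℝ) : ℝ := n * ((n + 1) * R) ^ 2 + overshoot n R

theorem stepError_nonneg (n : ℕ) (R : ℝ) : 0 ≤ stepError n R :=
  add_nonneg (by positivity) (overshoot_nonneg n R)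

theorem card_exceptional_le (hmin : 0 < Rmin) (hR : Rmax ≤ R) (h : S.Admissible Rmin Rmax)
    (hb : {p : S.Packet | S.IsBad ω ε C Γ p}.encard ≤ b) {t₂ : ℕ} {N : Finset S.Packet}
    (hN : ∀ p ∈ N, p.1 < t₂ ∧ (S.IsBad ω ε C Γ p ∨ t₂ < p.1 + ω)) :
    (N.card : ℝ) ≤ exceptional n ω b Rmin R := by
  classical
  have h1 : (N.filter fun p => S.IsBad ω ε C Γ p).card ≤ b := by
    have : ((N.filter fun p => S.IsBad ω ε C Γ p : Finset S.Packet) : Set S.Packet).encard ≤ b :=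
      (Set.encard_le_encard fun p hp => (Finset.mem_filter.1 hp).2).trans hb
    rw [Set.encard_coe_eq_coe_finsetCard] at this
    exact_mod_cast this
  have h2 : (N.filter fun p => ¬ S.IsBad ω ε C Γ p) ⊆
      (Finset.Ico (t₂ - ω) t₂).sigma fun _ => Finset.univ := by
    intro p hp
    rw [Finset.mem_filter] at hp
    have := hN p hp.1
    simp only [Finset.mem_sigma, Finset.mem_Ico, Finset.mem_univ, and_true]
    have := this.2.resolve_left hp.2
    omega
  have h3 := Finset.card_le_card h2
  rw [Finset.card_sigma] at h3
  simp only [Finset.card_univ, Fintype.card_fin] at h3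
  have h4 : ((∑ t ∈ Finset.Ico (t₂ - ω) t₂, S.count t : ℕ) : ℝ) ≤ ω * (n * R / Rmin) := by
    push_cast
    refine (Finset.sum_le_card_nsmul _ _ _ fun t _ => h.count_le hmin hR t).trans ?_
    rw [nsmul_eq_mul, Nat.card_Ico]
    have : 0 ≤ n * R / Rmin := (Nat.cast_nonneg _).trans (h.count_le hmin hR 0)
    gcongr
    omega
  have h5 := Finset.card_filter_add_card_filter_not (s := N) (fun p => S.IsBad ω ε C Γ p)
  have h6 : (N.card : ℝ) ≤ b + ((∑ t ∈ Finset.Ico (t₂ - ω) t₂, S.count t : ℕ) : ℝ) := by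
    exact_mod_cast h5.symm.le.trans (add_le_add h1 h3)
  rw [exceptional]
  linarith

/-- As long as the queues in `A` are separated from the others, the sum of the squares over `A`
exceeds its initial value by an amount that is bounded independently of the time. -/
theorem sum_sq_drift (hmin : 0 < Rmin) (hR : Rmax ≤ R) (hR0 : 0 ≤ R) (h : S.Admissible Rmin Rmax)
    (hdown : S.MovesDownhill) (hΓ : S.IsAssignment ω Γ)
    (hb : {p : S.Packet | S.IsBad ω ε C Γ p}.encard ≤ b) (hlt : hi < lo) (hhi : 0 ≤ hi)
    (hε : 0 < ε) (hε2 : ε < 2) (hω : 1 ≤ ω) (htop : 0 ≤ top) {t₁ t₂ : ℕ} (ht : t₁ ≤ t₂)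
    (hA : ∀ t, t₁ ≤ t → t < t₂ → S.Separated A lo hi top t)
    (hgain : -(ε / (1 - ε / 2)) * (Rmin * lo) + C + 1 + ω * (n * (n * (2 * R * hi))) +
      ω * stepError n R ≤ 0) :
    ∑ v ∈ A, S.queue t₂ v ^ 2 ≤ ∑ v ∈ A, S.queue t₁ v ^ 2 + overshoot n R +
      exceptional n ω b Rmin R * (2 * (R * top) + stepError n R) := by
  classical
  have hpos : ∀ t, t₁ ≤ t → t < t₂ → ∀ v ∈ A, 0 < S.queue t v := fun t h1 h2 v hv =>
    (hhi.trans_lt hlt).trans_le ((hA t h1 h2).lo_le v hv)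
  let P : Finset S.Packet :=
    ((Finset.Ico t₁ t₂).sigma fun _ => Finset.univ).filter fun p => S.source p.1 p.2 ∈ A
  -- Good packets are those whose negative drift is fully realized before `t₂`; the remaining ones,
  -- in `N`, are bad or too recent.
  let good : S.Packet → Prop := fun p => p.1 + ω ≤ t₂ ∧ ¬ S.IsBad ω ε C Γ p
  let G := P.filter good
  let N := P.filter fun p => ¬ good p
  -- All injections into `A` occur at active steps. Each good packet accounts for at most `ω` of
  -- these steps and each packet in `N` for one, so good packets can pay for their own step errors.
  let Act : Finset ℕ := N.image Sigma.fst ∪ G.biUnion fun p => Finset.Ico p.1 (p.1 + ω)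
  have hP : ∀ p ∈ P, t₁ ≤ p.1 ∧ p.1 < t₂ ∧ S.source p.1 p.2 ∈ A := by
    intro p hp
    simpa [P, and_assoc] using hp
  have hAct : ∀ t ∈ Act, t₁ ≤ t ∧ t < t₂ := by
    intro t ht'
    rcases Finset.mem_union.1 ht' with h1 | h1
    · obtain ⟨p, hp, rfl⟩ := Finset.mem_image.1 h1
      have := hP p (Finset.mem_filter.1 hp).1
      exact ⟨this.1, this.2.1⟩
    · obtain ⟨p, hp, hpt⟩ := Finset.mem_biUnion.1 h1
      obtain ⟨hp1, hp2⟩ := Finset.mem_filter.1 hp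
      have := hP p hp1
      rw [Finset.mem_Ico] at hpt
      exact ⟨this.1.trans hpt.1, hpt.2.trans_le hp2.1⟩
  have hPAct : ∀ p ∈ P, p.1 ∈ Act := by
    intro p hp
    by_cases hg : good p
    · exact Finset.mem_union_right _ (Finset.mem_biUnion.2
        ⟨p, Finset.mem_filter.2 ⟨hp, hg⟩, Finset.mem_Ico.2 ⟨le_rfl, by omega⟩⟩)
    · exact Finset.mem_union_left _ (Finset.mem_image.2
        ⟨p, Finset.mem_filter.2 ⟨hp, hg⟩, rfl⟩)
  let X : S.Packet → ℕ → ℝ := fun p t =>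
    ∑ u, ∑ v, 2 * Γ p t u v * (S.cutoff A t v - S.cutoff A t u)
  let inj : ℕ → ℝ := fun t =>
    ∑ k, if S.source t k ∈ A then S.size t k * S.height ⟨t, k⟩ else 0
  have hsh : ∀ p : S.Packet, 0 ≤ S.size p.1 p.2 * S.height p := fun p =>
    mul_nonneg (h.size_pos hmin _ _).le (h.queue_nonneg hmin _ _)
  have hmain := le_add_sum_active (Q := fun t => ∑ v ∈ A, S.queue t v ^ 2)
    (g := fun t => ∑ p ∈ G, X p t + 2 * inj t + n * ((n + 1) * R) ^ 2) (K := overshoot n R)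
    (Act := Act) ht ?_ ?_
  · have hfil : Act.filter (fun t => t₁ ≤ t ∧ t < t₂) = Act :=
      Finset.filter_true_of_mem hAct
    rw [hfil] at hmain
    have e1 : ∑ t ∈ Act, (∑ p ∈ G, X p t + 2 * inj t + n * ((n + 1) * R) ^ 2 + overshoot n R) =
        ∑ t ∈ Act, ∑ p ∈ G, X p t + 2 * ∑ t ∈ Act, inj t + Act.card * stepError n R := by
      simp only [Finset.sum_add_distrib, Finset.sum_const, nsmul_eq_mul, Finset.mul_sum, stepError]
      ring
    -- Good windows lie inside `Act`, and assignments vanish outside them, so the sum can be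
    -- regrouped by packet.
    have e2 : ∑ t ∈ Act, ∑ p ∈ G, X p t = ∑ p ∈ G, ∑ t ∈ Finset.Ico p.1 (p.1 + ω), X p t := by
      rw [Finset.sum_comm]
      refine Finset.sum_congr rfl fun p hp => ?_
      symm
      refine Finset.sum_subset (fun t ht' => Finset.mem_union_right _
        (Finset.mem_biUnion.2 ⟨p, hp, ht'⟩)) fun t _ ht' => ?_
      rw [Finset.mem_Ico] at ht'
      exact Finset.sum_eq_zero fun u _ => Finset.sum_eq_zero fun v _ => by
        rw [hΓ.window p t u v ht']; ring
    have e3 : ∑ t ∈ Act, inj t ≤ ∑ p ∈ P, S.size p.1 p.2 * S.height p := by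
      rw [Finset.sum_filter, Finset.sum_sigma]
      refine Finset.sum_le_sum_of_subset_of_nonneg
        (fun t ht' => Finset.mem_Ico.2 (hAct t ht')) fun t _ _ => Finset.sum_nonneg fun k _ => ?_
      split_ifs
      · exact hsh ⟨t, k⟩
      · exact le_rfl
    have e4 : ∑ p ∈ P, S.size p.1 p.2 * S.height p =
        ∑ p ∈ G, S.size p.1 p.2 * S.height p + ∑ p ∈ N, S.size p.1 p.2 * S.height p :=
      (Finset.sum_filter_add_sum_filter_not P good _).symm
    have e5 : (Act.card : ℝ) ≤ N.card + G.card * ω := by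
      have h1 : Act.card ≤ N.card + ∑ p ∈ G, ω := by
        refine (Finset.card_union_le _ _).trans (add_le_add Finset.card_image_le ?_)
        refine Finset.card_biUnion_le.trans (Finset.sum_le_sum fun p _ => ?_)
        simp
      rw [Finset.sum_const, smul_eq_mul] at h1
      exact_mod_cast h1
    have e6 : ∑ p ∈ G, (2 * (S.size p.1 p.2 * S.height p) +
        ∑ t ∈ Finset.Ico p.1 (p.1 + ω), X p t + ω * stepError n R) ≤ 0 := by
      refine Finset.sum_nonpos fun p hp => ?_
      obtain ⟨hp1, hp2⟩ := Finset.mem_filter.1 hp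
      have hp3 := hP p hp1
      have := packet_drift (A := A) (top := top) hmin hR hR0 h hdown hΓ hlt hhi hε hε2
        (fun t h1 h2 => hA t (hp3.1.trans h1) (h2.trans_le hp2.1)) hp2.2
        ((hA p.1 hp3.1 hp3.2.1).lo_le _ hp3.2.2)
      linarith
    have e7 : ∑ p ∈ N, S.size p.1 p.2 * S.height p ≤ N.card * (R * top) := by
      rw [← nsmul_eq_mul]
      refine Finset.sum_le_card_nsmul _ _ _ fun p hp => ?_
      have hp3 := hP p (Finset.mem_filter.1 hp).1
      exact mul_le_mul (h.size_le hmin hR _ _) ((hA p.1 hp3.1 hp3.2.1).le_top _ hp3.2.2)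
        (h.queue_nonneg hmin _ _) hR0
    have e8 : (N.card : ℝ) ≤ exceptional n ω b Rmin R := by
      refine card_exceptional_le hmin hR h hb (t₂ := t₂) fun p hp => ?_
      obtain ⟨hp1, hp2⟩ := Finset.mem_filter.1 hp
      refine ⟨(hP p hp1).2.1, ?_⟩
      by_contra hc
      push Not at hc
      exact hp2 ⟨hc.2, hc.1⟩
    have hse := stepError_nonneg n R
    have e9 := mul_le_mul_of_nonneg_right e5 hse
    have e10 : 0 ≤ 2 * (R * top) + stepError n R := by positivity
    have e11 := mul_le_mul_of_nonneg_right e8 e10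
    rw [Finset.sum_add_distrib, Finset.sum_add_distrib, ← Finset.mul_sum, Finset.sum_const,
      nsmul_eq_mul] at e6
    rw [e1, e2] at hmain
    linarith
  · intro t _ h1 h2
    have a1 := h.sum_sq_succ_le hmin hR hR0 (hpos t h1 h2)
    have a2 := (hA t h1 h2).sum_send_le hlt hmin h hdown hΓ G
    simp only [X, inj]
    linarith
  · intro s t h1 h2 h3 hq
    refine h.sum_sq_le_of_no_injection hmin hR hR0 hdown h2
      (fun r hr1 hr2 => hpos r (by omega) (by omega))
      (fun r hr1 hr2 v hv u hu => ?_) fun r hr1 hr2 v hv => ?_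
    · have := hA r (by omega) (by omega)
      linarith [this.lo_le v hv, this.le_hi u hu]
    · refine Finset.sum_eq_zero fun k _ => if_neg fun hk => ?_
      refine hq r (hPAct ⟨r, k⟩ ?_) hr1 hr2
      simp only [P, Finset.mem_filter, Finset.mem_sigma, Finset.mem_Ico, Finset.mem_univ, and_true,
        hk, hv]
      omega

end QueuePlay

/-! ### Caps on all sets of queues and the choice of scale -/

namespace QueuePlay

variable {n : ℕ} {S : QueuePlay n} {Rmin Rmax R : ℝ} {ω b : ℕ} {ε C : ℝ}
  {Γ : S.Packet → ℕ → Fin n → Fin n → ℝ} {X M q₀ : ℝ}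

/-- The largest sum of squares that is allowed over `k` queues, when the `k`-th tallest queue may
have a size of about `X / M ^ k`. -/
noncomputable def levelSum (X M : ℝ) (k : ℕ) : ℝ := ∑ i ∈ Finset.range k, (X / M ^ (i + 1)) ^ 2

theorem levelSum_succ (X M : ℝ) (k : ℕ) :
    levelSum X M (k + 1) = levelSum X M k + (X / M ^ (k + 1)) ^ 2 := Finset.sum_range_succ _ _

theorem levelSum_nonneg (X M : ℝ) (k : ℕ) : 0 ≤ levelSum X M k :=
  Finset.sum_nonneg fun _ _ => sq_nonneg _

/-- The distance from the allowed sums of squares within which a set of queues is separated from the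
other queues. -/
noncomputable def slack (n ω b : ℕ) (Rmin R X : ℝ) : ℝ :=
  overshoot n R + exceptional n ω b Rmin R * (2 * (R * X) + stepError n R) +
    n * (2 * X * ((n + 1) * R) + ((n + 1) * R) ^ 2)

theorem slack_nonneg (hmin : 0 < Rmin) (hR0 : 0 ≤ R) (hX : 0 ≤ X) :
    0 ≤ slack n ω b Rmin R X := by
  have := overshoot_nonneg n R
  have := stepError_nonneg n R
  have : 0 ≤ exceptional n ω b Rmin R := by unfold exceptional; positivity
  unfold slack
  positivity

theorem div_pow_anti (hX : 0 ≤ X) (hM : 1 ≤ M) {j k : ℕ} (hjk : j ≤ k) :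
    X / M ^ k ≤ X / M ^ j :=
  div_le_div_of_nonneg_left hX (by positivity) (pow_le_pow_right₀ hM hjk)

theorem Admissible.sum_sq_succ_le_of_le (h : S.Admissible Rmin Rmax) (hmin : 0 < Rmin)
    (hR : Rmax ≤ R) (hR0 : 0 ≤ R) (hX : 0 ≤ X) {t : ℕ} (A : Finset (Fin n))
    (hA : ∀ v ∈ A, S.queue t v ≤ X) :
    ∑ v ∈ A, S.queue (t + 1) v ^ 2 ≤ ∑ v ∈ A, S.queue t v ^ 2 +
      n * (2 * X * ((n + 1) * R) + ((n + 1) * R) ^ 2) := by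
  have h1 : ∀ v ∈ A, S.queue (t + 1) v ^ 2 ≤ S.queue t v ^ 2 +
      (2 * X * ((n + 1) * R) + ((n + 1) * R) ^ 2) := by
    intro v hv
    have h2 := pow_le_pow_left₀ (h.queue_nonneg hmin (t + 1) v)
      (h.queue_succ_le hmin hR hR0 t v) 2
    have h3 : S.queue t v * ((n + 1) * R) ≤ X * ((n + 1) * R) :=
      mul_le_mul_of_nonneg_right (hA v hv) (by positivity)
    linarith [add_sq (S.queue t v) ((n + 1) * R)]
  have h2 := Finset.sum_le_sum h1
  rw [Finset.sum_add_distrib, Finset.sum_const, nsmul_eq_mul] at h2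
  have h3 : (A.card : ℝ) * (2 * X * ((n + 1) * R) + ((n + 1) * R) ^ 2) ≤
      n * (2 * X * ((n + 1) * R) + ((n + 1) * R) ^ 2) := by
    have : (A.card : ℝ) ≤ n := by
      exact_mod_cast (Finset.card_le_univ A).trans_eq (Fintype.card_fin n)
    gcongr
  linarith

theorem queue_le_of_levelSum (hX : 0 ≤ X) (hM : 0 < M) {t : ℕ}
    (hle : ∀ A : Finset (Fin n), ∑ v ∈ A, S.queue t v ^ 2 ≤ levelSum X M A.card) (v : Fin n) :
    S.queue t v ≤ X / M := by
  have h1 := hle {v}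
  rw [Finset.sum_singleton, Finset.card_singleton, levelSum_succ] at h1
  simp only [levelSum, Finset.range_zero, Finset.sum_empty, zero_add, pow_one] at h1
  exact le_of_sq_le_sq h1 (by positivity)

/-- A member of `A` has square at least the last increment of the cap minus `s`, hence at least a
quarter of that increment. An outside queue has square at most the next increment plus `s`, hence
less than four times it. The bound on `s` at level `n` serves all levels. -/
theorem separated_of_levelSum (h : S.Admissible Rmin Rmax) (hmin : 0 < Rmin) (hX : 0 ≤ X)
    (hM : 4 < M) {s : ℝ} (hs : s ≤ 3 / 4 * (X / M ^ n) ^ 2) {t : ℕ}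
    (hle : ∀ A : Finset (Fin n), ∑ v ∈ A, S.queue t v ^ 2 ≤ levelSum X M A.card)
    {A : Finset (Fin n)} (hA : levelSum X M A.card - s < ∑ v ∈ A, S.queue t v ^ 2) :
    S.Separated A (X / M ^ A.card / 2) (2 * (X / M ^ (A.card + 1))) X t := by
  have hM0 : 0 < M := by linarith
  have hsk : ∀ k ≤ n, s ≤ 3 / 4 * (X / M ^ k) ^ 2 := fun k hk => by
    have := pow_le_pow_left₀ (by positivity) (div_pow_anti hX (by linarith : 1 ≤ M) hk) 2
    linarith
  have hcard : A.card ≤ n := (Finset.card_le_univ A).trans_eq (Fintype.card_fin n)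
  refine ⟨fun v hv => ?_, fun v _ => ?_, fun u hu => ?_⟩
  · have h1 := hle (A.erase v)
    rw [Finset.card_erase_of_mem hv] at h1
    have h2 := Finset.add_sum_erase A (fun v => S.queue t v ^ 2) hv
    have h3 := hsk _ hcard
    obtain ⟨k, hk⟩ : ∃ k, A.card = k + 1 := ⟨A.card - 1, by
      have := Finset.card_pos.2 ⟨v, hv⟩
      omega⟩
    rw [hk] at h1 hA h3 ⊢
    rw [levelSum_succ] at hA
    simp only [Nat.add_sub_cancel] at h1
    refine le_of_sq_le_sq ?_ (h.queue_nonneg hmin t v)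
    rw [div_pow]
    linarith
  · exact (queue_le_of_levelSum hX hM0 hle v).trans (div_le_self hX (by linarith))
  · have h1 := hle (insert u A)
    have hcard' : (insert u A).card ≤ n :=
      (Finset.card_le_univ _).trans_eq (Fintype.card_fin n)
    rw [Finset.card_insert_of_notMem hu] at h1 hcard'
    rw [Finset.sum_insert hu, levelSum_succ] at h1
    have h3 := hsk _ hcard'
    refine le_of_sq_le_sq ?_ (by positivity)
    rw [mul_pow]
    linarith [sq_nonneg (X / M ^ (A.card + 1))]

/-- The induction treats all sets at once, since isolating `A` uses the caps of its neighbours.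
After the last time `A` was at least `slack` below its cap, one step and then the drift estimate use
up no more than `slack`. -/
theorem sum_sq_le_levelSum (hmin : 0 < Rmin) (hR : Rmax ≤ R) (hR0 : 0 ≤ R)
    (h : S.Admissible Rmin Rmax) (hdown : S.MovesDownhill) (hΓ : S.IsAssignment ω Γ)
    (hb : {p : S.Packet | S.IsBad ω ε C Γ p}.encard ≤ b)
    (hε : 0 < ε) (hε2 : ε < 2) (hω : 1 ≤ ω) (hX : 0 < X) (hM : 4 < M)
    (hinit : ∀ v, S.init v ≤ q₀)
    (hslack : n * q₀ ^ 2 + slack n ω b Rmin R X ≤ 3 / 4 * (X / M ^ n) ^ 2)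
    (hgain : ∀ k ≤ n, -(ε / (1 - ε / 2)) * (Rmin * (X / M ^ k / 2)) + C + 1 +
      ω * (n * (n * (2 * R * (2 * (X / M ^ (k + 1)))))) + ω * stepError n R ≤ 0) (T : ℕ) :
    ∀ A : Finset (Fin n), ∑ v ∈ A, S.queue T v ^ 2 ≤ levelSum X M A.card := by
  classical
  have hM0 : 0 < M := by linarith
  have hsl := slack_nonneg (n := n) (ω := ω) (b := b) hmin hR0 hX.le
  have hzero : ∀ A : Finset (Fin n), A.Nonempty →
      ∑ v ∈ A, S.queue 0 v ^ 2 ≤ levelSum X M A.card - slack n ω b Rmin R X := by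
    intro A hA
    have hcard : A.card ≤ n := (Finset.card_le_univ A).trans_eq (Fintype.card_fin n)
    have h1 := Finset.sum_le_card_nsmul A (fun v => S.queue 0 v ^ 2) (q₀ ^ 2) fun v _ =>
      pow_le_pow_left₀ (h.queue_nonneg hmin 0 v) (by rw [queue]; exact hinit v) 2
    rw [nsmul_eq_mul] at h1
    have h2 : (A.card : ℝ) * q₀ ^ 2 ≤ n * q₀ ^ 2 := by gcongr
    have h3 := pow_le_pow_left₀ (by positivity) (div_pow_anti hX.le (by linarith : 1 ≤ M) hcard) 2
    obtain ⟨k, hk⟩ : ∃ k, A.card = k + 1 := ⟨A.card - 1, by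
      have := Finset.card_pos.2 hA
      omega⟩
    rw [hk] at h3 ⊢
    rw [levelSum_succ]
    have := levelSum_nonneg X M k
    have := sq_nonneg (X / M ^ n)
    linarith
  induction T using Nat.strong_induction_on with
  | _ T ih =>
    intro A
    rcases A.eq_empty_or_nonempty with rfl | hne
    · simpa using levelSum_nonneg X M 0
    rcases T with _ | T
    · linarith [hzero A hne]
    let p : ℕ → Prop := fun t =>
      ∑ v ∈ A, S.queue t v ^ 2 ≤ levelSum X M A.card - slack n ω b Rmin R X
    set r := Nat.findGreatest p T with hr
    have hrT : r ≤ T := Nat.findGreatest_le T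
    have hpr : p r := Nat.findGreatest_spec (P := p) (Nat.zero_le T) (hzero A hne)
    -- Separation is needed only before time `T + 1`, so the caps at earlier times suffice.
    have hafter : ∀ t, r + 1 ≤ t → t < T + 1 → S.Separated A (X / M ^ A.card / 2)
        (2 * (X / M ^ (A.card + 1))) X t := by
      intro t h1 h2
      refine separated_of_levelSum h hmin hX.le hM (s := slack n ω b Rmin R X) ?_ (ih t h2) ?_
      · have : 0 ≤ n * q₀ ^ 2 := by positivity
        linarith
      · exact not_le.1 (Nat.findGreatest_is_greatest (P := p) (by omega : r < t) (by omega))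
    have htop : ∀ v ∈ A, S.queue r v ≤ X := fun v _ =>
      (queue_le_of_levelSum hX.le hM0 (ih r (by omega)) v).trans (div_le_self hX.le (by linarith))
    have hstep := h.sum_sq_succ_le_of_le hmin hR hR0 hX.le A htop
    have hcard : A.card ≤ n := (Finset.card_le_univ A).trans_eq (Fintype.card_fin n)
    have hlt : 2 * (X / M ^ (A.card + 1)) < X / M ^ A.card / 2 := by
      rw [pow_succ, ← div_div]
      have : 0 < X / M ^ A.card := by positivity
      have h4 : X / M ^ A.card / M < X / M ^ A.card / 4 :=
        div_lt_div_of_pos_left this (by norm_num) hM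
      linarith
    have hdrift := sum_sq_drift hmin hR hR0 h hdown hΓ hb hlt (by positivity) hε hε2 hω hX.le
      (by omega : r + 1 ≤ T + 1) hafter (hgain _ hcard)
    have hpr' : ∑ v ∈ A, S.queue r v ^ 2 ≤ levelSum X M A.card - slack n ω b Rmin R X := hpr
    unfold slack at hpr'
    linarith

/-- The scale of the queue sizes can be chosen so large that all error terms are dominated. -/
theorem exists_scale (n ω b : ℕ) (q₀ : ℝ) (hmin : 0 < Rmin) (hR0 : 0 ≤ R) (hε : 0 < ε)
    (hε2 : ε < 2) : ∃ X M : ℝ, 0 < X ∧ 4 < M ∧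
      n * q₀ ^ 2 + slack n ω b Rmin R X ≤ 3 / 4 * (X / M ^ n) ^ 2 ∧
      ∀ k ≤ n, -(ε / (1 - ε / 2)) * (Rmin * (X / M ^ k / 2)) + C + 1 +
        ω * (n * (n * (2 * R * (2 * (X / M ^ (k + 1)))))) + ω * stepError n R ≤ 0 := by
  have hε' : 0 < ε / (1 - ε / 2) := div_pos hε (by linarith)
  set c := ε / (1 - ε / 2) * Rmin with hc
  have hc0 : 0 < c := mul_pos hε' hmin
  set a : ℝ := 4 * (ω * (n * (n * R))) with ha
  have ha0 : 0 ≤ a := by positivity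
  -- `M` is fixed first, to make the low-queue error at most half of the gain at every level,
  -- whatever `X` is.
  obtain ⟨M, hM4, hM⟩ : ∃ M : ℝ, 4 < M ∧ a ≤ c / 4 * M := by
    refine ⟨5 + 4 * a / c, by linarith [show 0 ≤ 4 * a / c by positivity], ?_⟩
    have : c / 4 * (5 + 4 * a / c) = 5 * c / 4 + a := by field_simp
    linarith
  have hM0 : 0 < M := by linarith
  obtain ⟨α, β, hαβ⟩ : ∃ α β : ℝ, ∀ X, n * q₀ ^ 2 + slack n ω b Rmin R X = α * X + β :=
    ⟨exceptional n ω b Rmin R * (2 * R) + n * (2 * ((n + 1) * R)),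
      n * q₀ ^ 2 + overshoot n R + exceptional n ω b Rmin R * stepError n R +
        n * ((n + 1) * R) ^ 2, fun X => by unfold slack; ring⟩
  set d := C + 1 + ω * stepError n R with hd
  set γ : ℝ := 3 / 4 / (M ^ n) ^ 2 with hγ
  have hγ0 : 0 < γ := by positivity
  -- The second entry lets the quadratic margin beat the affine slack; the third lets the other half
  -- of the gain cover the constant `d`, even at the lowest level `n`.
  set X : ℝ := max 1 (max ((|α| + |β|) / γ) (4 * |d| * M ^ n / c)) with hX
  have hX1 : 1 ≤ X := le_max_left _ _
  have hX2 : |α| + |β| ≤ X * γ := by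
    rw [← div_le_iff₀ hγ0]
    exact (le_max_left _ _).trans (le_max_right _ _)
  have hX3 : 4 * |d| * M ^ n ≤ X * c := by
    rw [← div_le_iff₀ hc0]
    exact (le_max_right _ _).trans (le_max_right _ _)
  refine ⟨X, M, by linarith, hM4, ?_, fun k hk => ?_⟩
  · have e : 3 / 4 * (X / M ^ n) ^ 2 = X * γ * X := by rw [hγ]; field_simp
    rw [hαβ, e]
    have h1 := mul_le_mul_of_nonneg_right hX2 (by linarith : 0 ≤ X)
    have h2 := mul_le_mul_of_nonneg_right (le_abs_self α) (by linarith : 0 ≤ X)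
    have h3 := mul_le_mul_of_nonneg_left hX1 (abs_nonneg β)
    linarith [le_abs_self β]
  · have h1 := div_pow_anti (by linarith : 0 ≤ X) (by linarith : 1 ≤ M) hk
    have h2 : |d| ≤ c / 4 * (X / M ^ n) := by
      rw [← mul_div_assoc, le_div_iff₀ (by positivity)]
      linarith
    have h3 := mul_le_mul_of_nonneg_left h1 (by positivity : 0 ≤ c / 4)
    have h4 : a * (X / M ^ (k + 1)) ≤ c / 4 * (X / M ^ k) := by
      have := mul_le_mul_of_nonneg_right hM (by positivity : 0 ≤ X / M ^ (k + 1))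
      have e : c / 4 * M * (X / M ^ (k + 1)) = c / 4 * (X / M ^ k) := by
        rw [pow_succ]; field_simp
      linarith
    have e : -(ε / (1 - ε / 2)) * (Rmin * (X / M ^ k / 2)) + C + 1 +
        ω * (n * (n * (2 * R * (2 * (X / M ^ (k + 1)))))) + ω * stepError n R =
        -(c / 2 * (X / M ^ k)) + d + a * (X / M ^ (k + 1)) := by
      rw [hc, hd, ha]; ring
    rw [e]
    linarith [le_abs_self d]

/-- Queue sizes are bounded in terms of the initial sizes and the number of bad packets. -/
theorem exists_queue_bound (ω : ℕ) (Rmax C : ℝ) (hmin : 0 < Rmin) (hε : 0 < ε) (hε2 : ε < 2)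
    (hω : 1 ≤ ω) (n : ℕ) (q₀ : ℝ) (b : ℕ) :
    ∃ U : ℝ, ∀ S : QueuePlay n, S.Admissible Rmin Rmax → S.IsAdversarial ω ε C b →
      S.MovesDownhill → (∀ v, S.init v ≤ q₀) → ∀ t v, S.queue t v ≤ U := by
  -- `|Rmax|` serves as `R`, because the sign of `Rmax` is not prescribed.
  have hR0 : 0 ≤ |Rmax| := abs_nonneg _
  obtain ⟨X, M, hX, hM, hslack, hgain⟩ :=
    exists_scale (C := C) n ω b q₀ hmin hR0 hε hε2
  refine ⟨X / M, fun S h ⟨Γ, hΓ, hb⟩ hdown hinit t v => ?_⟩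
  exact queue_le_of_levelSum hX.le (by linarith) (sum_sq_le_levelSum hmin (le_abs_self Rmax) hR0 h
    hdown hΓ hb hε hε2 hω hX hM hinit hslack hgain t) v

end QueuePlay

theorem mainTheorem2 (Rmin Rmax ε C : ℝ) (ω : ℕ) (hRmin : 0 < Rmin) (hε : 0 < ε) (hε2 : ε < 2)
    (hω : 1 ≤ ω) :
    ∃ U : ℕ → ℝ → ℕ → ℝ, ∀ (n b : ℕ) (S : QueuePlay n),
      S.Admissible Rmin Rmax → S.IsAdversarial ω ε C b → S.MovesDownhill →
        S.Stable ∧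
          ∀ q₀ : ℝ, (∀ v, S.init v ≤ q₀) → ∀ t v, S.queue t v ≤ U n q₀ b := by
  choose U hU using QueuePlay.exists_queue_bound ω Rmax C hRmin hε hε2 hω
  -- For stability, the sum of the initial sizes serves as `q₀`.
  refine ⟨U, fun n b S h hadv hdown => ⟨⟨U n (∑ v, S.init v) b, ?_⟩, fun q₀ h0 =>
    hU n q₀ b S h hadv hdown h0⟩⟩
  exact hU n _ b S h hadv hdown fun v =>
    Finset.single_le_sum (fun u _ => h.init_nonneg u) (Finset.mem_univ v)
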